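/- Let $q\in\mathbb{C}$ with $0<|q|<1$. Put $(x;q)_\infty=\prod_{k\ge 0}(1-xq^k)$, $(x;q)_n=\prod_{k=0}^{n-1}(1-xq^k)$ for integers $n\ge 0$, and $\varphi(-q)=\dfrac{(q;q)_\infty}{(-q;q)_\infty}$. Then $\varphi(-q)\neq 0$, the three series below converge absolutely, and $$\sum_{n=1}^{\infty}\frac{(-q;q)_{n-1}}{(q;q)_{2n-1}}\,\frac{q^{3n^2/2-n/2}}{1+q^n} =-\frac{1}{\varphi(-q)}\sum_{n\in\mathbb{Z}}\frac{1-q^{3n}}{1+q^{3n}}\,q^{15n^2/2+n/2} +\frac{1}{\varphi(-q)}\sum_{n\in\mathbb{Z}}\frac{1-q^{3n+1}}{1+q^{3n+1}}\,q^{15n^2/2+11n/2+1}.$$ -/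

import Mathlib

namespace QSeries

/-- The finite `q`-shifted factorial `(x; q)_n = ∏_{k=0}^{n-1} (1 - x q^k)` for `n ≥ 0`. -/
noncomputable def qPoch (x q : ℂ) (n : ℕ) : ℂ :=
  ∏ k ∈ Finset.range n, (1 - x * q ^ k)

/-- The infinite `q`-shifted factorial `(x; q)_∞ = ∏_{k=0}^∞ (1 - x q^k)`, for `|q| < 1`. -/
noncomputable def qPochInf (x q : ℂ) : ℂ :=
  ∏' k : ℕ, (1 - x * q ^ k)

/-- The infinite product `(x; q)_∞` converges for `|q| < 1`. -/
theorem multipliable_qPochInf (x q : ℂ) (hq : ‖q‖ < 1) :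
    Multipliable fun k : ℕ => (1 - x * q ^ k) := by
  have h : Summable fun k : ℕ => ‖-(x * q ^ k)‖ := by
    simpa [norm_mul, norm_pow] using
      (summable_geometric_of_lt_one (norm_nonneg q) hq).mul_left ‖x‖
  simpa [sub_eq_add_neg] using multipliable_one_add_of_summable h

/-- The value `φ(-q) = (q; q)_∞ / (-q; q)_∞` of the theta function `φ` at `-q`. -/
noncomputable def phiNeg (q : ℂ) : ℂ :=
  qPochInf q q / qPochInf (-q) q

/-- The summand `(-q; q)_{n-1} / (q; q)_{2n-1} · q^{3n²/2 - n/2} / (1 + q^n)`, for `n ≥ 1`.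
The exponent `(3n² - n) / 2` is a natural number and both truncated operations are exact. -/
noncomputable def mod15Term (q : ℂ) (n : ℕ+) : ℂ :=
  qPoch (-q) q ((n : ℕ) - 1) / qPoch q q (2 * (n : ℕ) - 1)
    * (q ^ ((3 * (n : ℕ) ^ 2 - (n : ℕ)) / 2) / (1 + q ^ (n : ℕ)))

/-- The summand `(1 - q^{3n}) / (1 + q^{3n}) · q^{15n²/2 + n/2}`, for `n ∈ ℤ`.
The division by `2` is exact because `15n² + n` is even. -/
noncomputable def lambertTerm₀ (q : ℂ) (n : ℤ) : ℂ :=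
  (1 - q ^ (3 * n)) / (1 + q ^ (3 * n)) * q ^ ((15 * n ^ 2 + n) / 2)

/-- The summand `(1 - q^{3n+1}) / (1 + q^{3n+1}) · q^{15n²/2 + 11n/2 + 1}`, for `n ∈ ℤ`.
The division by `2` is exact because `15n² + 11n` is even. -/
noncomputable def lambertTerm₁ (q : ℂ) (n : ℤ) : ℂ :=
  (1 - q ^ (3 * n + 1)) / (1 + q ^ (3 * n + 1)) * q ^ ((15 * n ^ 2 + 11 * n) / 2 + 1)

end QSeries

namespace QSeries

open Filter Topology

/-! Bailey's method with kernel $K(n,r)=1/((q;q)_{n-r}(q;q)_{n+r})$. Suppose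
$\beta_n=\sum_r\alpha_rK(n,r)$ and $\sum_n w_nK(n,r)=\gamma_r$; interchanging the sums gives $\sum_n
w_n\beta_n=\sum_r\alpha_r\gamma_r$.

The pair is `tsum_baileyPair_sub`: $\alpha$ lives on $r\equiv 0,1 \pmod 3$, which yields the two
Lambert series. It comes from Slater's pair `tsum_baileyPair` and the relation `tsum_contiguous`.

The conjugate pair is `hasSum_baileyWeight`:
$\gamma_r=\frac{2}{\varphi(-q)}\,\frac{q^{r(r+1)/2}}{1+q^r}$. Telescoping in $n$ shows that
$q^{-r(r+1)/2}(1+q^r)\sum_n w_nK(n,r)$ does not depend on $r\ge 0$, and $r\to\infty$ gives its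
value. `summable_prod_baileyWeight` justifies the interchange. -/

/-! ### Recurrences for the Bailey kernel -/

/-- The reciprocal `1 / (q; q)_j`, extended by zero to negative indices `j`. -/
noncomputable def invPoch (q : ℂ) (j : ℤ) : ℂ :=
  if 0 ≤ j then (qPoch q q j.toNat)⁻¹ else 0

/-- The kernel `1 / ((q; q)_{n-r} (q; q)_{n+r})` of Bailey pairs relative to `1`. -/
noncomputable def baileyKernel (q : ℂ) (n : ℕ) (r : ℤ) : ℂ :=
  invPoch q (n - r) * invPoch q (n + r)

theorem qPoch_succ (x q : ℂ) (n : ℕ) : qPoch x q (n + 1) = qPoch x q n * (1 - x * q ^ n) :=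
  Finset.prod_range_succ _ _

theorem one_sub_pow_ne_zero {q : ℂ} (hq : ‖q‖ < 1) {n : ℕ} (hn : n ≠ 0) : 1 - q ^ n ≠ 0 := by
  intro h
  have h1 : ‖q ^ n‖ < 1 := by
    rw [norm_pow]
    exact pow_lt_one₀ (norm_nonneg q) hq hn
  rw [← sub_eq_zero.mp h, norm_one] at h1
  exact lt_irrefl _ h1

theorem one_add_pow_ne_zero {q : ℂ} (hq : ‖q‖ < 1) (n : ℕ) : 1 + q ^ n ≠ 0 := by
  rcases eq_or_ne n 0 with rfl | hn
  · norm_num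
  intro h
  apply one_sub_pow_ne_zero hq (n := n * 2) (by omega)
  rw [pow_mul]
  linear_combination (1 - q ^ n) * h

theorem qPoch_self_ne_zero {q : ℂ} (hq : ‖q‖ < 1) (n : ℕ) : qPoch q q n ≠ 0 := by
  refine Finset.prod_ne_zero_iff.mpr fun k _ => ?_
  rw [← pow_succ']
  exact one_sub_pow_ne_zero hq k.succ_ne_zero

theorem invPoch_natCast (q : ℂ) (n : ℕ) : invPoch q n = (qPoch q q n)⁻¹ := by
  simp [invPoch]

theorem invPoch_of_neg (q : ℂ) {j : ℤ} (hj : j < 0) : invPoch q j = 0 :=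
  if_neg (not_le.mpr hj)

/-- Extension by zero makes the recurrence hold at every integer: at `j = 0` the factor `1 - q ^ j`
vanishes too. Boundary cases of the kernel identities thus need no separate treatment. -/
theorem invPoch_sub_one {q : ℂ} (hq : ‖q‖ < 1) (j : ℤ) :
    invPoch q (j - 1) = (1 - q ^ j) * invPoch q j := by
  rcases lt_trichotomy j 0 with hj | rfl | hj
  · rw [invPoch_of_neg q hj, invPoch_of_neg q (by omega), mul_zero]
  · rw [invPoch_of_neg q (by omega)]
    simp
  · obtain ⟨n, rfl⟩ : ∃ n : ℕ, j = n + 1 := ⟨(j - 1).toNat, by omega⟩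
    rw [add_sub_cancel_right, invPoch_natCast]
    have h1 : ((n : ℤ) + 1) = ((n + 1 : ℕ) : ℤ) := by push_cast; rfl
    rw [h1, invPoch_natCast, zpow_natCast, qPoch_succ, ← pow_succ']
    have := one_sub_pow_ne_zero hq n.succ_ne_zero
    have := qPoch_self_ne_zero hq n
    field_simp

theorem baileyKernel_neg (q : ℂ) (n : ℕ) (r : ℤ) :
    baileyKernel q n (-r) = baileyKernel q n r := by
  simp only [baileyKernel, sub_neg_eq_add, ← sub_eq_add_neg]
  exact mul_comm _ _

theorem baileyKernel_eq_zero (q : ℂ) {n : ℕ} {r : ℤ} (h : n < |r|) : baileyKernel q n r = 0 := by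
  rcases lt_abs.mp h with h | h
  · rw [baileyKernel, invPoch_of_neg q (by omega), zero_mul]
  · rw [baileyKernel, invPoch_of_neg q (j := n + r) (by omega), mul_zero]

theorem one_sub_mul_baileyKernel {q : ℂ} (hq : ‖q‖ < 1) (n : ℕ) (r : ℤ) :
    (1 - q ^ (n - r)) * baileyKernel q n r =
      (1 - q ^ (n + r + 1)) * baileyKernel q n (r + 1) := by
  have h1 := invPoch_sub_one hq (n - r)
  have h2 := invPoch_sub_one hq (n + r + 1)
  rw [add_sub_cancel_right] at h2
  rw [baileyKernel, baileyKernel, ← sub_sub, ← add_assoc, h1, h2]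
  ring

/-- With $x=m+1-r$ and $y=m+1+r$, every term is a multiple of $1/((q;q)_x(q;q)_y)$, and a rational
identity in $q^x$, $q^y$ and $q$ remains. It drives the induction on `n` in `tsum_baileyPair`. -/
theorem baileyKernel_succ {q : ℂ} (hq0 : q ≠ 0) (hq : ‖q‖ < 1) (m : ℕ) (r : ℤ) :
    (1 - q ^ (2 * m + 1)) * (1 - q ^ (2 * m + 2)) * baileyKernel q (m + 1) r =
      q ^ (m + 1 + r) * baileyKernel q m (r + 1) + (1 + q ^ (2 * m + 1)) * baileyKernel q m r +
        q ^ (m + 1 - r) * baileyKernel q m (r - 1) := by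
  simp only [baileyKernel]
  push_cast
  generalize hx : (m : ℤ) + 1 - r = x
  generalize hy : (m : ℤ) + 1 + r = y
  have e1 : (m : ℤ) - (r + 1) = x - 1 - 1 := by omega
  have e2 : (m : ℤ) + (r + 1) = y := by omega
  have e3 : (m : ℤ) - r = x - 1 := by omega
  have e4 : (m : ℤ) + r = y - 1 := by omega
  have e5 : (m : ℤ) - (r - 1) = x := by omega
  have e6 : (m : ℤ) + (r - 1) = y - 1 - 1 := by omega
  have e7 : q ^ (2 * m + 2) = q ^ x * q ^ y := by
    rw [← zpow_add₀ hq0, ← zpow_natCast]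
    congr 1
    push_cast
    omega
  have e8 : q ^ (2 * m + 1) = q ^ x * q ^ y / q := by
    rw [← e7, pow_succ q (2 * m + 1), mul_div_cancel_right₀ _ hq0]
  rw [e1, e2, e3, e4, e5, e6, e7, e8, invPoch_sub_one hq (x - 1), invPoch_sub_one hq (y - 1),
    invPoch_sub_one hq x, invPoch_sub_one hq y, zpow_sub_one₀ hq0, zpow_sub_one₀ hq0]
  field_simp
  ring

/-! ### Bailey pairs supported on residues 0 and 1 modulo 3 -/

theorem summable_mul_baileyKernel (q : ℂ) (n : ℕ) (g : ℤ → ℂ) (a : ℤ) :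
    Summable fun k => g k * baileyKernel q n (3 * k + a) := by
  refine summable_of_hasFiniteSupport
    ((Set.finite_Icc (-(n : ℤ) - |a|) (n + |a|)).subset fun k hk => ?_)
  have h : |3 * k + a| ≤ n := by
    by_contra h
    exact hk (by simp [baileyKernel_eq_zero q (not_le.mp h)])
  have h1 := abs_le.mp h
  have h2 := neg_abs_le a
  have h3 := le_abs_self a
  rw [Set.mem_Icc]
  omega

theorem summable_mul_baileyKernel_three_mul (q : ℂ) (n : ℕ) (g : ℤ → ℂ) :
    Summable fun k => g k * baileyKernel q n (3 * k) := by
  simpa using summable_mul_baileyKernel q n g 0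

theorem zpow_three_mul_sq_add {q : ℂ} (hq0 : q ≠ 0) (k a b : ℤ) :
    q ^ (3 * k ^ 2 + a * k + b) = q ^ (3 * k ^ 2) * (q ^ k) ^ a * q ^ b := by
  rw [zpow_add₀ hq0, zpow_add₀ hq0, mul_comm a k, zpow_mul q k a]

theorem tsum_zpow_mul_baileyKernel_neg (q : ℂ) (n : ℕ) (a b : ℤ) :
    ∑' k : ℤ, q ^ (3 * k ^ 2 - a * k + b) * baileyKernel q n (3 * k) =
      ∑' k : ℤ, q ^ (3 * k ^ 2 + a * k + b) * baileyKernel q n (3 * k) := by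
  rw [← (Equiv.neg ℤ).tsum_eq]
  refine tsum_congr fun k => ?_
  rw [Equiv.neg_apply, mul_neg 3 k, baileyKernel_neg]
  congr 2
  ring

/-- The contiguous relation linking the two Bailey pairs. -/
theorem tsum_contiguous {q : ℂ} (hq0 : q ≠ 0) (hq : ‖q‖ < 1) (n : ℕ) :
    ∑' k : ℤ, q ^ (3 * k ^ 2 - k) * baileyKernel q n (3 * k) -
      ∑' k : ℤ, q ^ (3 * k ^ 2 + k) * baileyKernel q n (3 * k + 1) =
    q ^ n * (∑' k : ℤ, q ^ (3 * k ^ 2 + 2 * k) * baileyKernel q n (3 * k) -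
      ∑' k : ℤ, q ^ (3 * k ^ 2 + 4 * k + 1) * baileyKernel q n (3 * k + 1)) := by
  have h1 := tsum_zpow_mul_baileyKernel_neg q n 1 0
  have h2 := tsum_zpow_mul_baileyKernel_neg q n 2 0
  simp only [one_mul, add_zero] at h1 h2
  -- After $k\mapsto -k$ in the two sums over `3 * k`, the identity holds term by term: it is
  -- `one_sub_mul_baileyKernel` at `r = 3 * k`, scaled by $q^{3k^2+k}$.
  rw [h1, ← h2,
    ← (summable_mul_baileyKernel_three_mul q n _).tsum_sub (summable_mul_baileyKernel q n _ _),
    ← (summable_mul_baileyKernel_three_mul q n _).tsum_sub (summable_mul_baileyKernel q n _ _),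
    ← tsum_mul_left]
  refine tsum_congr fun k => ?_
  have h3 := one_sub_mul_baileyKernel hq n (3 * k)
  have e1 := zpow_three_mul_sq_add hq0 k 1 0
  have e2 := zpow_three_mul_sq_add hq0 k (-2) 0
  have e3 := zpow_three_mul_sq_add hq0 k 4 1
  have e4 : q ^ ((n : ℤ) - 3 * k) = q ^ n / (q ^ k) ^ 3 := by
    rw [zpow_sub₀ hq0, zpow_natCast, mul_comm, zpow_mul]
    norm_cast
  have e5 : q ^ ((n : ℤ) + 3 * k + 1) = q ^ n * (q ^ k) ^ 3 * q := by
    rw [zpow_add_one₀ hq0, zpow_add₀ hq0, zpow_natCast, mul_comm 3 k, zpow_mul]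
    norm_cast
  have hX : q ^ k ≠ 0 := zpow_ne_zero _ hq0
  simp only [add_zero, one_mul, zpow_zero, mul_one, zpow_one, neg_mul, ← sub_eq_add_neg]
    at e1 e2 e3
  rw [e1, e2, e3]
  rw [e4, e5] at h3
  have e6 : (q ^ k) ^ (4 : ℤ) = (q ^ k) ^ 4 := by norm_cast
  have e7 : (q ^ k) ^ (-2 : ℤ) = ((q ^ k) ^ 2)⁻¹ := by
    rw [zpow_neg]
    norm_cast
  rw [e6, e7]
  field_simp at h3 ⊢
  linear_combination h3

/-- Slater's Bailey pair with `β_n = q^{n²} / (q; q)_{2n}`. -/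
theorem tsum_baileyPair {q : ℂ} (hq0 : q ≠ 0) (hq : ‖q‖ < 1) (n : ℕ) :
    ∑' k : ℤ, q ^ (3 * k ^ 2 - k) * baileyKernel q n (3 * k) -
      ∑' k : ℤ, q ^ (3 * k ^ 2 + k) * baileyKernel q n (3 * k + 1) =
    q ^ n ^ 2 / qPoch q q (2 * n) := by
  induction n with
  | zero =>
    rw [tsum_eq_single 0, tsum_eq_single 0]
    · simp [baileyKernel, invPoch, qPoch]
    · intro k hk
      rw [baileyKernel_eq_zero, mul_zero]
      simp only [Nat.cast_zero, abs_pos]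
      omega
    · intro k hk
      rw [baileyKernel_eq_zero, mul_zero]
      simp only [Nat.cast_zero, abs_pos]
      omega
  | succ m ih =>
    have hc := tsum_contiguous hq0 hq m
    have hJ := tsum_zpow_mul_baileyKernel_neg q m 2 0
    simp only [add_zero] at hJ
    have hF : ∑' k : ℤ, q ^ (3 * k ^ 2 - 4 * k + 1) * baileyKernel q m (3 * k + -1) =
        ∑' k : ℤ, q ^ (3 * k ^ 2 + 4 * k + 1) * baileyKernel q m (3 * k + 1) := by
      rw [← (Equiv.neg ℤ).tsum_eq]
      refine tsum_congr fun k => ?_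
      rw [Equiv.neg_apply, ← baileyKernel_neg q m (3 * k + 1)]
      congr 2 <;> ring
    -- The reflection $k\mapsto -1-k$ sends $3k+2$ to $-(3k+1)$, and the kernel is even in `r`.
    have hH : ∑' k : ℤ, q ^ (3 * k ^ 2 + 4 * k + 2) * baileyKernel q m (3 * k + 2) =
        ∑' k : ℤ, q ^ (3 * k ^ 2 + 2 * k + 1) * baileyKernel q m (3 * k + 1) := by
      rw [← (Equiv.subLeft (-1 : ℤ)).tsum_eq]
      refine tsum_congr fun k => ?_
      rw [Equiv.subLeft_apply, ← baileyKernel_neg q m (3 * k + 1)]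
      congr 2 <;> ring
    have hs0 := fun (n : ℕ) (g : ℤ → ℂ) => (summable_mul_baileyKernel_three_mul q n g).hasSum
    have hs := fun (n : ℕ) (g : ℤ → ℂ) (a : ℤ) => (summable_mul_baileyKernel q n g a).hasSum
    have hL := ((hs0 (m + 1) fun k => q ^ (3 * k ^ 2 - k)).sub
      (hs (m + 1) (fun k => q ^ (3 * k ^ 2 + k)) 1)).mul_left
        ((1 - q ^ (2 * m + 1)) * (1 - q ^ (2 * m + 2)))
    have hR := (((hs0 m fun k => q ^ (3 * k ^ 2 - k)).sub
      (hs m (fun k => q ^ (3 * k ^ 2 + k)) 1)).mul_left (q ^ (2 * m + 1) + 1)).add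
        (((((hs m (fun k => q ^ (3 * k ^ 2 + 2 * k + 1)) 1).add
          (hs m (fun k => q ^ (3 * k ^ 2 - 4 * k + 1)) (-1))).sub
          (hs m (fun k => q ^ (3 * k ^ 2 + 4 * k + 2)) 2)).sub
          (hs0 m fun k => q ^ (3 * k ^ 2 - 2 * k))).mul_left (q ^ m))
    have key := hL.unique (hR.congr_fun ?_)
    -- By `hH` two of the sums cancel. The others form $-q^m$ times the bracket of `hc`, that is,
    -- minus the left side at `m`; so $(1+q^{2m+1})-1=q^{2m+1}$ is the factor gained.
    · rw [hF, hH, hJ] at key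
      have h1 := one_sub_pow_ne_zero hq (n := 2 * m + 1) (by omega)
      have h2 := one_sub_pow_ne_zero hq (n := 2 * m + 2) (by omega)
      have h3 := qPoch_self_ne_zero hq (2 * m)
      rw [show 2 * (m + 1) = 2 * m + 1 + 1 by ring, qPoch_succ, qPoch_succ, ← pow_succ',
        ← pow_succ', eq_div_iff (by positivity), show (m + 1) ^ 2 = 2 * m + 1 + m ^ 2 by ring,
        pow_add]
      rw [eq_div_iff h3] at ih
      linear_combination qPoch q q (2 * m) * (key + hc) + q ^ (2 * m + 1) * ih
    · intro k
      have h1 := baileyKernel_succ hq0 hq m (3 * k)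
      have h2 := baileyKernel_succ hq0 hq m (3 * k + 1)
      rw [show 3 * k + 1 + 1 = 3 * k + 2 by ring, add_sub_cancel_right] at h2
      rw [sub_eq_add_neg (3 * k) 1] at h1
      have e (a b c : ℤ) (h : a + b = m + c) : q ^ a * q ^ b = q ^ m * q ^ c := by
        rw [← zpow_add₀ hq0, h, zpow_add₀ hq0, zpow_natCast]
      have e1 := e (3 * k ^ 2 - k) (m + 1 + 3 * k) (3 * k ^ 2 + 2 * k + 1) (by ring)
      have e2 := e (3 * k ^ 2 - k) (m + 1 - 3 * k) (3 * k ^ 2 - 4 * k + 1) (by ring)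
      have e3 := e (3 * k ^ 2 + k) (m + 1 + (3 * k + 1)) (3 * k ^ 2 + 4 * k + 2) (by ring)
      have e4 := e (3 * k ^ 2 + k) (m + 1 - (3 * k + 1)) (3 * k ^ 2 - 2 * k) (by ring)
      linear_combination q ^ (3 * k ^ 2 - k) * h1 - q ^ (3 * k ^ 2 + k) * h2 +
        baileyKernel q m (3 * k + 1) * e1 + baileyKernel q m (3 * k + -1) * e2 -
        baileyKernel q m (3 * k + 2) * e3 - baileyKernel q m (3 * k) * e4

/-- The Bailey pair with `β_n = (1 - q^n) q^{n² - n} / (q; q)_{2n}`. -/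
theorem tsum_baileyPair_sub {q : ℂ} (hq0 : q ≠ 0) (hq : ‖q‖ < 1) (n : ℕ) :
    ∑' k : ℤ, ((-((1 - q ^ (3 * k)) * q ^ (3 * k ^ 2 - k))) * baileyKernel q n (3 * k) +
      (1 - q ^ (3 * k + 1)) * q ^ (3 * k ^ 2 + k) * baileyKernel q n (3 * k + 1)) =
    (1 - q ^ n) * q ^ (n ^ 2 - n) / qPoch q q (2 * n) := by
  have hc := tsum_contiguous hq0 hq n
  have hb := tsum_baileyPair hq0 hq n
  have hs0 := fun g : ℤ → ℂ => (summable_mul_baileyKernel_three_mul q n g).hasSum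
  have hs := fun g : ℤ → ℂ => (summable_mul_baileyKernel q n g 1).hasSum
  have h := (((hs0 fun k => q ^ (3 * k ^ 2 + 2 * k)).sub
    (hs fun k => q ^ (3 * k ^ 2 + 4 * k + 1))).sub
    ((hs0 fun k => q ^ (3 * k ^ 2 - k)).sub (hs fun k => q ^ (3 * k ^ 2 + k))))
  refine (HasSum.tsum_eq (h.congr_fun fun k => ?_)).trans ?_
  · have e1 : q ^ (3 * k) * q ^ (3 * k ^ 2 - k) = q ^ (3 * k ^ 2 + 2 * k) := by
      rw [← zpow_add₀ hq0]
      ring_nf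
    have e2 : q ^ (3 * k + 1) * q ^ (3 * k ^ 2 + k) = q ^ (3 * k ^ 2 + 4 * k + 1) := by
      rw [← zpow_add₀ hq0]
      ring_nf
    linear_combination baileyKernel q n (3 * k) * e1 - baileyKernel q n (3 * k + 1) * e2
  · have h3 := qPoch_self_ne_zero hq (2 * n)
    have h4 : q ^ n ^ 2 = q ^ n * q ^ (n ^ 2 - n) := by
      rw [← pow_add, Nat.add_sub_cancel' (Nat.le_self_pow two_ne_zero n)]
    have h5 : q ^ n ≠ 0 := pow_ne_zero n hq0
    rw [hc, h4, mul_div_assoc] at hb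
    rw [hc, mul_left_cancel₀ h5 hb]
    ring

/-! ### Infinite products, limits and uniform bounds -/

theorem tendsto_qPoch (x : ℂ) {q : ℂ} (hq : ‖q‖ < 1) :
    Tendsto (qPoch x q) atTop (𝓝 (qPochInf x q)) :=
  (multipliable_qPochInf x q hq).hasProd.tendsto_prod_nat

theorem qPochInf_ne_zero {x q : ℂ} (hq : ‖q‖ < 1) (h : ∀ k, 1 - x * q ^ k ≠ 0) :
    qPochInf x q ≠ 0 := by
  simp only [qPochInf, sub_eq_add_neg] at h ⊢
  refine tprod_one_add_ne_zero_of_summable h ?_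
  simpa [norm_mul, norm_pow] using
    (summable_geometric_of_lt_one (norm_nonneg q) hq).mul_left ‖x‖

theorem qPochInf_self_ne_zero {q : ℂ} (hq : ‖q‖ < 1) : qPochInf q q ≠ 0 := by
  refine qPochInf_ne_zero hq fun k => ?_
  rw [← pow_succ']
  exact one_sub_pow_ne_zero hq k.succ_ne_zero

theorem qPochInf_neg_self_ne_zero {q : ℂ} (hq : ‖q‖ < 1) : qPochInf (-q) q ≠ 0 := by
  refine qPochInf_ne_zero hq fun k => ?_
  rw [neg_mul, sub_neg_eq_add, ← pow_succ']
  exact one_add_pow_ne_zero hq _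

theorem phiNeg_ne_zero {q : ℂ} (hq : ‖q‖ < 1) : phiNeg q ≠ 0 :=
  div_ne_zero (qPochInf_self_ne_zero hq) (qPochInf_neg_self_ne_zero hq)

theorem qPoch_neg_one_succ (q : ℂ) (n : ℕ) : qPoch (-1) q (n + 1) = 2 * qPoch (-q) q n := by
  rw [qPoch, Finset.prod_range_succ', mul_comm, qPoch]
  congr 1
  · norm_num
  · refine Finset.prod_congr rfl fun k _ => ?_
    ring

theorem tendsto_qPoch_neg_one {q : ℂ} (hq : ‖q‖ < 1) :
    Tendsto (qPoch (-1) q) atTop (𝓝 (2 * qPochInf (-q) q)) := by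
  rw [← tendsto_add_atTop_iff_nat 1]
  simpa only [qPoch_neg_one_succ] using (tendsto_qPoch (-q) hq).const_mul 2

theorem tendsto_invPoch {q : ℂ} (hq : ‖q‖ < 1) :
    Tendsto (fun n : ℕ => invPoch q n) atTop (𝓝 (qPochInf q q)⁻¹) := by
  simpa only [invPoch_natCast] using (tendsto_qPoch q hq).inv₀ (qPochInf_self_ne_zero hq)

theorem exists_norm_le_of_tendsto {u : ℕ → ℂ} {a : ℂ} (h : Tendsto u atTop (𝓝 a)) :
    ∃ B, ∀ n, ‖u n‖ ≤ B := by
  obtain ⟨B, hB⟩ := h.norm.bddAbove_range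
  exact ⟨B, fun n => hB (Set.mem_range_self n)⟩

theorem exists_norm_invPoch_le {q : ℂ} (hq : ‖q‖ < 1) : ∃ B, 0 ≤ B ∧ ∀ j, ‖invPoch q j‖ ≤ B := by
  obtain ⟨B, hB⟩ := exists_norm_le_of_tendsto (tendsto_invPoch hq)
  have hB0 : 0 ≤ B := (norm_nonneg _).trans (hB 0)
  refine ⟨B, hB0, fun j => ?_⟩
  rcases lt_or_ge j 0 with hj | hj
  · rw [invPoch_of_neg q hj, norm_zero]
    exact hB0
  · lift j to ℕ using hj
    exact hB j

/-! ### The conjugate Bailey pair -/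

/-- The weight `(-1; q)_n q^{n(n+1)/2}` of the Bailey lemma with `ρ₁ = -1`, `ρ₂ → ∞`. -/
noncomputable def baileyWeight (q : ℂ) (n : ℕ) : ℂ :=
  qPoch (-1) q n * q ^ (n * (n + 1) / 2)

theorem triangle_add (m r : ℕ) :
    (m + r) * (m + r + 1) / 2 = m * (m + 1) / 2 + m * r + r * (r + 1) / 2 := by
  have h1 := Nat.even_mul_succ_self m
  have h2 := Nat.even_mul_succ_self r
  obtain ⟨a, ha⟩ := h1
  obtain ⟨b, hb⟩ := h2
  have h3 : (m + r) * (m + r + 1) = m * (m + 1) + 2 * (m * r) + r * (r + 1) := by ring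
  omega

theorem baileyWeight_succ (q : ℂ) (n : ℕ) :
    baileyWeight q (n + 1) = (1 + q ^ n) * q ^ (n + 1) * baileyWeight q n := by
  have h := triangle_add n 1
  rw [baileyWeight, baileyWeight, qPoch_succ, h]
  norm_num [pow_add]
  ring

theorem le_triangle (n : ℕ) : n ≤ n * (n + 1) / 2 := by
  rw [Nat.le_div_iff_mul_le two_pos]
  rcases n.eq_zero_or_pos with rfl | hn
  · simp
  · exact Nat.mul_le_mul_left n (by omega)

theorem exists_norm_baileyWeight_le {q : ℂ} (hq : ‖q‖ < 1) :
    ∃ W, 0 ≤ W ∧ ∀ n, ‖baileyWeight q n‖ ≤ W * ‖q‖ ^ n := by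
  obtain ⟨W, hW⟩ := exists_norm_le_of_tendsto (tendsto_qPoch_neg_one hq)
  have hW0 : 0 ≤ W := (norm_nonneg _).trans (hW 0)
  refine ⟨W, hW0, fun n => ?_⟩
  rw [baileyWeight, norm_mul, norm_pow]
  exact mul_le_mul (hW n) (pow_le_pow_of_le_one (norm_nonneg q) hq.le (le_triangle n))
    (by positivity) hW0

theorem summable_baileyWeight_mul {q : ℂ} (hq : ‖q‖ < 1) {u : ℕ → ℂ} {B : ℝ}
    (hu : ∀ n, ‖u n‖ ≤ B) : Summable fun n => baileyWeight q n * u n := by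
  obtain ⟨W, hW0, hW⟩ := exists_norm_baileyWeight_le hq
  refine Summable.of_norm_bounded
    (((summable_geometric_of_lt_one (norm_nonneg q) hq).mul_left W).mul_right B) fun n => ?_
  rw [norm_mul]
  exact mul_le_mul (hW n) (hu n) (norm_nonneg _) (by positivity)

theorem exists_norm_baileyKernel_le {q : ℂ} (hq : ‖q‖ < 1) :
    ∃ B, 0 ≤ B ∧ ∀ n r, ‖baileyKernel q n r‖ ≤ B := by
  obtain ⟨B, hB0, hB⟩ := exists_norm_invPoch_le hq
  refine ⟨B * B, by positivity, fun n r => ?_⟩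
  rw [baileyKernel, norm_mul]
  exact mul_le_mul (hB _) (hB _) (norm_nonneg _) hB0

theorem summable_baileyWeight_mul_baileyKernel {q : ℂ} (hq : ‖q‖ < 1) (r : ℤ) :
    Summable fun n => baileyWeight q n * baileyKernel q n r := by
  obtain ⟨B, -, hB⟩ := exists_norm_baileyKernel_le hq
  exact summable_baileyWeight_mul hq fun n => hB n r

theorem tsum_baileyWeight_succ {q : ℂ} (hq0 : q ≠ 0) (hq : ‖q‖ < 1) (r : ℕ) :
    (1 + q ^ (r + 1)) * ∑' n, baileyWeight q n * baileyKernel q n (r + 1 : ℕ) =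
      (1 + q ^ r) * q ^ (r + 1) * ∑' n, baileyWeight q n * baileyKernel q n r := by
  -- Telescoping certificate: the difference of the two summands is `G (n + 1) - G n`. `G 0`
  -- vanishes because its index `-r - 1` is negative, and `G` tends to `0`.
  set G : ℕ → ℂ := fun n =>
    (1 - q ^ (2 * r + 1)) * (baileyWeight q n * (invPoch q (n - r - 1) * invPoch q (n + r)))
    with hG
  have hs : Summable fun n : ℕ =>
      baileyWeight q n * (invPoch q (n - r - 1) * invPoch q (n + r)) := by
    obtain ⟨B, hB0, hB⟩ := exists_norm_invPoch_le hq
    refine summable_baileyWeight_mul hq (B := B * B) fun n => ?_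
    rw [norm_mul]
    exact mul_le_mul (hB _) (hB _) (norm_nonneg _) hB0
  have hGlim : Tendsto G atTop (𝓝 0) := by
    simpa using hs.tendsto_atTop_zero.const_mul (1 - q ^ (2 * r + 1))
  have hG0 : G 0 = 0 := by
    simp only [hG]
    rw [invPoch_of_neg q (by omega)]
    ring
  have h1 := ((summable_baileyWeight_mul_baileyKernel hq r).hasSum.mul_left
    ((1 + q ^ r) * q ^ (r + 1))).sub
    ((summable_baileyWeight_mul_baileyKernel hq (r + 1 : ℕ)).hasSum.mul_left (1 + q ^ (r + 1)))
  have hstep (n : ℕ) : (1 + q ^ r) * q ^ (r + 1) * (baileyWeight q n * baileyKernel q n r) -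
      (1 + q ^ (r + 1)) * (baileyWeight q n * baileyKernel q n (r + 1 : ℕ)) = G (n + 1) - G n := by
    simp only [hG, baileyWeight_succ, baileyKernel]
    push_cast
    have e1 := invPoch_sub_one hq (n - r)
    have e2 := invPoch_sub_one hq (n + r + 1)
    rw [add_sub_cancel_right] at e2
    rw [show (n : ℤ) - (r + 1) = n - r - 1 by ring, show (n : ℤ) + 1 - r - 1 = n - r by ring,
      show (n : ℤ) + 1 + r = n + r + 1 by ring, ← add_assoc, e1, e2, zpow_add_one₀ hq0,
      zpow_add₀ hq0, zpow_sub₀ hq0]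
    simp only [zpow_natCast]
    have hr : q ^ r ≠ 0 := pow_ne_zero r hq0
    field_simp
    ring
  have h2 := h1.tendsto_sum_nat
  simp only [hstep, Finset.sum_range_sub, hG0, sub_zero] at h2
  exact (sub_eq_zero.mp (tendsto_nhds_unique h2 hGlim)).symm

/-- Terms with `n < r` vanish. Putting `n = m + r` extracts the decaying power of `q`, so that the
remaining sum has a nonzero limit as $r\to\infty$. -/
theorem tsum_baileyWeight_shift {q : ℂ} (hq : ‖q‖ < 1) (r : ℕ) :
    ∑' n, baileyWeight q n * baileyKernel q n r =
      q ^ (r * (r + 1) / 2) * ∑' m : ℕ, q ^ (m * (m + 1) / 2 + m * r) *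
        (qPoch (-1) q (m + r) * (invPoch q m * invPoch q (m + 2 * r : ℕ))) := by
  rw [← (summable_baileyWeight_mul_baileyKernel hq r).sum_add_tsum_nat_add r,
    Finset.sum_eq_zero, zero_add, ← tsum_mul_left]
  · refine tsum_congr fun m => ?_
    rw [baileyWeight, baileyKernel, triangle_add, pow_add q _ (r * (r + 1) / 2)]
    push_cast
    rw [add_sub_cancel_right, show (m : ℤ) + r + r = m + 2 * r by ring]
    ring
  · intro n hn
    rw [Finset.mem_range] at hn
    rw [baileyKernel_eq_zero, mul_zero]
    rw [abs_of_nonneg (by positivity)]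
    exact_mod_cast hn

/-- Dominated convergence: $q^{mr}$ kills every term with $m\ge 1$, and $m=0$ contributes
$(-1;q)_\infty/(q;q)_\infty$. -/
theorem tendsto_tsum_shift {q : ℂ} (hq : ‖q‖ < 1) :
    Tendsto (fun r : ℕ => ∑' m : ℕ, q ^ (m * (m + 1) / 2 + m * r) *
        (qPoch (-1) q (m + r) * (invPoch q m * invPoch q (m + 2 * r : ℕ)))) atTop
      (𝓝 (2 / phiNeg q)) := by
  obtain ⟨B, hB0, hB⟩ := exists_norm_invPoch_le hq
  obtain ⟨W, hW⟩ := exists_norm_le_of_tendsto (tendsto_qPoch_neg_one hq)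
  have hW0 : 0 ≤ W := (norm_nonneg _).trans (hW 0)
  have hbd (m r : ℕ) : ‖qPoch (-1) q (m + r) * (invPoch q m * invPoch q (m + 2 * r : ℕ))‖ ≤
      W * (B * B) := by
    rw [norm_mul, norm_mul]
    have := hB m
    have := hB (m + 2 * r : ℕ)
    have := hW (m + r)
    gcongr
  have hlim (m : ℕ) : Tendsto (fun r : ℕ => q ^ (m * (m + 1) / 2 + m * r) *
      (qPoch (-1) q (m + r) * (invPoch q m * invPoch q (m + 2 * r : ℕ)))) atTop
      (𝓝 (if m = 0 then 2 / phiNeg q else 0)) := by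
    split_ifs with hm
    · subst hm
      have h1 : Tendsto (fun r : ℕ => 2 * r) atTop atTop :=
        tendsto_id.const_mul_atTop' two_pos
      have h2 := (tendsto_qPoch_neg_one hq).mul ((tendsto_invPoch hq).comp h1)
      have h3 : 2 / phiNeg q = 2 * qPochInf (-q) q * (qPochInf q q)⁻¹ := by
        rw [phiNeg, div_div_eq_mul_div, div_eq_mul_inv]
      rw [h3]
      have h4 : invPoch q (0 : ℕ) = 1 := by simp [invPoch, qPoch]
      refine h2.congr fun r => ?_
      simp only [h4, Function.comp_apply, zero_mul, Nat.zero_div, zero_add, pow_zero, one_mul]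
    · refine squeeze_zero_norm (a := fun r => ‖q‖ ^ r * (W * (B * B))) (fun r => ?_) ?_
      · rw [norm_mul, norm_pow]
        refine mul_le_mul (pow_le_pow_of_le_one (norm_nonneg q) hq.le ?_) (hbd m r)
          (norm_nonneg _) (by positivity)
        exact (Nat.le_mul_of_pos_left r (Nat.pos_of_ne_zero hm)).trans (Nat.le_add_left _ _)
      · simpa using (tendsto_pow_atTop_nhds_zero_of_lt_one (norm_nonneg q) hq).mul_const
          (W * (B * B))
  have := tendsto_tsum_of_dominated_convergence
    (bound := fun m => ‖q‖ ^ m * (W * (B * B)))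
    ((summable_geometric_of_lt_one (norm_nonneg q) hq).mul_right _) hlim
    (Eventually.of_forall fun r m => ?_)
  · simpa only [tsum_ite_eq] using this
  · rw [norm_mul, norm_pow]
    exact mul_le_mul (pow_le_pow_of_le_one (norm_nonneg q) hq.le
      ((le_triangle m).trans (Nat.le_add_right _ _))) (hbd m r) (norm_nonneg _) (by positivity)

theorem tsum_baileyWeight_nat {q : ℂ} (hq0 : q ≠ 0) (hq : ‖q‖ < 1) (r : ℕ) :
    (1 + q ^ r) * ∑' n, baileyWeight q n * baileyKernel q n r =
      2 / phiNeg q * q ^ (r * (r + 1) / 2) := by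
  set S : ℕ → ℂ := fun r => ∑' m : ℕ, q ^ (m * (m + 1) / 2 + m * r) *
        (qPoch (-1) q (m + r) * (invPoch q m * invPoch q (m + 2 * r : ℕ))) with hS
  have hV (r : ℕ) : ∑' n, baileyWeight q n * baileyKernel q n r = q ^ (r * (r + 1) / 2) * S r :=
    tsum_baileyWeight_shift hq r
  have hlim : Tendsto (fun r : ℕ => (1 + q ^ r) * S r) atTop (𝓝 (2 / phiNeg q)) := by
    have h := ((tendsto_pow_atTop_nhds_zero_of_norm_lt_one hq).const_add 1).mul
      (tendsto_tsum_shift hq)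
    rwa [add_zero, one_mul] at h
  have hconst (r : ℕ) : (1 + q ^ (r + 1)) * S (r + 1) = (1 + q ^ r) * S r := by
    have h := tsum_baileyWeight_succ hq0 hq r
    have ht : (r + 1) * (r + 1 + 1) / 2 = r * (r + 1) / 2 + (r + 1) := by
      have := triangle_add r 1
      omega
    rw [hV, hV, ht, pow_add] at h
    have h1 : q ^ (r * (r + 1) / 2) ≠ 0 := pow_ne_zero _ hq0
    have h2 : q ^ (r + 1) ≠ 0 := pow_ne_zero _ hq0
    refine mul_left_cancel₀ (mul_ne_zero h1 h2) ?_
    linear_combination h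
  have hall (k : ℕ) : (1 + q ^ (k + r)) * S (k + r) = (1 + q ^ r) * S r := by
    induction k with
    | zero => rw [zero_add]
    | succ k ih => rw [← ih, ← hconst (k + r), Nat.add_right_comm]
  have h := (tendsto_add_atTop_iff_nat r).mpr hlim
  simp only [hall] at h
  rw [hV, ← tendsto_nhds_unique tendsto_const_nhds h]
  ring

theorem one_add_zpow_ne_zero {q : ℂ} (hq0 : q ≠ 0) (hq : ‖q‖ < 1) (r : ℤ) : 1 + q ^ r ≠ 0 := by
  obtain ⟨n, rfl | rfl⟩ := r.eq_nat_or_neg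
  · rw [zpow_natCast]
    exact one_add_pow_ne_zero hq n
  · have h1 := one_add_pow_ne_zero hq n
    have h2 : q ^ n ≠ 0 := pow_ne_zero n hq0
    rw [zpow_neg, zpow_natCast]
    intro h
    field_simp at h
    exact h1 (by linear_combination h)

/-- The conjugate Bailey pair relative to `1` with `ρ₁ = -1` and `ρ₂ → ∞`. -/
theorem hasSum_baileyWeight {q : ℂ} (hq0 : q ≠ 0) (hq : ‖q‖ < 1) (r : ℤ) :
    HasSum (fun n => baileyWeight q n * baileyKernel q n r)
      (2 / phiNeg q * (q ^ (r * (r + 1) / 2) / (1 + q ^ r))) := by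
  convert (summable_baileyWeight_mul_baileyKernel hq r).hasSum using 1
  rw [← mul_div_assoc, div_eq_iff (one_add_zpow_ne_zero hq0 hq r)]
  obtain ⟨n, rfl | rfl⟩ := r.eq_nat_or_neg
  · have h := tsum_baileyWeight_nat hq0 hq n
    rw [show (n : ℤ) * (n + 1) / 2 = (n * (n + 1) / 2 : ℕ) by push_cast; rfl, zpow_natCast,
      zpow_natCast, ← h, mul_comm]
  -- Both sides are even in `r`: $q^{r(r+1)/2}/(1+q^r)$ is unchanged by $r\mapsto -r$.
  · have h := tsum_baileyWeight_nat hq0 hq n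
    have ht : -(n : ℤ) * (-n + 1) / 2 = (n * (n + 1) / 2 : ℕ) - n := by
      push_cast
      rw [show -(n : ℤ) * (-n + 1) = n * (n + 1) + (-n) * 2 by ring,
        Int.add_mul_ediv_right _ _ two_ne_zero]
      ring
    have h2 : q ^ n ≠ 0 := pow_ne_zero n hq0
    simp only [baileyKernel_neg]
    rw [ht, zpow_sub₀ hq0, zpow_neg, zpow_natCast, zpow_natCast]
    field_simp
    field_simp at h
    linear_combination -h

/-! ### Absolute convergence of the double series -/

theorem norm_zpow_le_one {q : ℂ} (hq : ‖q‖ < 1) {e : ℤ} (he : 0 ≤ e) : ‖q ^ e‖ ≤ 1 := by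
  lift e to ℕ using he
  rw [zpow_natCast, norm_pow]
  exact pow_le_one₀ (norm_nonneg q) hq.le

theorem summable_pow_natAbs {s : ℝ} (hs0 : 0 ≤ s) (hs1 : s < 1) :
    Summable fun j : ℤ => s ^ j.natAbs := by
  refine Summable.of_nat_of_neg ?_ ?_ <;> simpa using summable_geometric_of_lt_one hs0 hs1

theorem summable_prod_baileyWeight {q : ℂ} (hq : ‖q‖ < 1) {g : ℤ → ℂ} {M : ℝ}
    (hg : ∀ k, ‖g k‖ ≤ M) {e : ℤ → ℤ} (he : Function.Injective e) :
    Summable fun p : ℕ × ℤ => baileyWeight q p.1 * (g p.2 * baileyKernel q p.1 (e p.2)) := by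
  obtain ⟨W, hW0, hW⟩ := exists_norm_baileyWeight_le hq
  obtain ⟨B, hB0, hB⟩ := exists_norm_baileyKernel_le hq
  have hM0 : 0 ≤ M := (norm_nonneg _).trans (hg 0)
  -- The kernel vanishes unless $|e(k)|\le n$, so $|q|^n=s^n s^n\le s^n s^{|e(k)|}$: half the decay
  -- in `n` pays for summability in `k`.
  set s := √‖q‖ with hs
  have hs0 : 0 ≤ s := Real.sqrt_nonneg _
  have hs2 : s ^ 2 = ‖q‖ := Real.sq_sqrt (norm_nonneg q)
  have hs1 : s < 1 := by
    rw [← hs2] at hq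
    exact (sq_lt_one_iff₀ hs0).mp hq
  have h := (summable_geometric_of_lt_one hs0 hs1).mul_of_nonneg
    ((summable_pow_natAbs hs0 hs1).comp_injective he) (fun _ => pow_nonneg hs0 _)
    (fun _ => pow_nonneg hs0 _)
  refine Summable.of_norm_bounded (h.mul_left (W * (M * B))) fun ⟨n, k⟩ => ?_
  simp only [Function.comp_apply]
  rcases lt_or_ge (n : ℤ) |e k| with hn | hn
  · rw [baileyKernel_eq_zero q hn, mul_zero, mul_zero, norm_zero]
    positivity
  · have h1 : ‖q‖ ^ n ≤ s ^ n * s ^ (e k).natAbs := by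
      rw [← hs2, ← pow_mul, ← pow_add]
      exact pow_le_pow_of_le_one hs0 hs1.le (by
        rw [← Int.natCast_natAbs] at hn
        omega)
    have h2 := hW n
    have h3 := hg k
    have h4 := hB n (e k)
    rw [norm_mul, norm_mul]
    calc ‖baileyWeight q n‖ * (‖g k‖ * ‖baileyKernel q n (e k)‖)
        ≤ (W * (s ^ n * s ^ (e k).natAbs)) * (M * B) := by
          gcongr
          exact h2.trans (mul_le_mul_of_nonneg_left h1 hW0)
      _ = _ := by ring

/-- For `k < 0` the factor `1 - q ^ (3 * k)` alone is unbounded; after expanding, both exponents are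
nonnegative. -/
theorem norm_coeff₀_le {q : ℂ} (hq0 : q ≠ 0) (hq : ‖q‖ < 1) (k : ℤ) :
    ‖-((1 - q ^ (3 * k)) * q ^ (3 * k ^ 2 - k))‖ ≤ 2 := by
  have h : (1 - q ^ (3 * k)) * q ^ (3 * k ^ 2 - k) =
      q ^ (3 * k ^ 2 - k) - q ^ (3 * k ^ 2 + 2 * k) := by
    rw [sub_mul, one_mul, ← zpow_add₀ hq0]
    ring_nf
  have h1 : 0 ≤ 3 * k ^ 2 - k := by
    rcases le_or_gt k 0 with hk | hk <;> nlinarith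
  have h2 : 0 ≤ 3 * k ^ 2 + 2 * k := by
    rcases lt_or_ge k 0 with hk | hk <;> nlinarith
  rw [norm_neg, h]
  linarith [norm_sub_le (q ^ (3 * k ^ 2 - k)) (q ^ (3 * k ^ 2 + 2 * k)),
    norm_zpow_le_one hq h1, norm_zpow_le_one hq h2]

theorem norm_coeff₁_le {q : ℂ} (hq0 : q ≠ 0) (hq : ‖q‖ < 1) (k : ℤ) :
    ‖(1 - q ^ (3 * k + 1)) * q ^ (3 * k ^ 2 + k)‖ ≤ 2 := by
  have h : (1 - q ^ (3 * k + 1)) * q ^ (3 * k ^ 2 + k) =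
      q ^ (3 * k ^ 2 + k) - q ^ (3 * k ^ 2 + 4 * k + 1) := by
    rw [sub_mul, one_mul, ← zpow_add₀ hq0]
    ring_nf
  have h1 : 0 ≤ 3 * k ^ 2 + k := by
    rcases lt_or_ge k 0 with hk | hk <;> nlinarith
  have h2 : 0 ≤ 3 * k ^ 2 + 4 * k + 1 := by
    rcases lt_or_ge k 0 with hk | hk <;> nlinarith
  rw [h]
  linarith [norm_sub_le (q ^ (3 * k ^ 2 + k)) (q ^ (3 * k ^ 2 + 4 * k + 1)),
    norm_zpow_le_one hq h1, norm_zpow_le_one hq h2]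

/-! ### Identification of the terms and conclusion -/

theorem hasSum_lambertTerm₀ {q : ℂ} (hq0 : q ≠ 0) (hq : ‖q‖ < 1) (k : ℤ) :
    HasSum (fun n => baileyWeight q n *
      (-((1 - q ^ (3 * k)) * q ^ (3 * k ^ 2 - k)) * baileyKernel q n (3 * k)))
      (-(2 / phiNeg q) * lambertTerm₀ q k) := by
  have h := (hasSum_baileyWeight hq0 hq (3 * k)).mul_left
    (-((1 - q ^ (3 * k)) * q ^ (3 * k ^ 2 - k)))
  have he : q ^ ((15 * k ^ 2 + k) / 2) =
      q ^ (3 * k ^ 2 - k) * q ^ (3 * k * (3 * k + 1) / 2) := by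
    rw [← zpow_add₀ hq0, show 15 * k ^ 2 + k = 3 * k * (3 * k + 1) + (3 * k ^ 2 - k) * 2 by ring,
      Int.add_mul_ediv_right _ _ two_ne_zero, add_comm]
  rw [show -(2 / phiNeg q) * lambertTerm₀ q k = _ * _ from ?_]
  · exact h.congr_fun fun n => by ring
  · rw [lambertTerm₀, he]
    ring

theorem hasSum_lambertTerm₁ {q : ℂ} (hq0 : q ≠ 0) (hq : ‖q‖ < 1) (k : ℤ) :
    HasSum (fun n => baileyWeight q n *
      ((1 - q ^ (3 * k + 1)) * q ^ (3 * k ^ 2 + k) * baileyKernel q n (3 * k + 1)))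
      (2 / phiNeg q * lambertTerm₁ q k) := by
  have h := (hasSum_baileyWeight hq0 hq (3 * k + 1)).mul_left
    ((1 - q ^ (3 * k + 1)) * q ^ (3 * k ^ 2 + k))
  have he : q ^ ((15 * k ^ 2 + 11 * k) / 2 + 1) =
      q ^ (3 * k ^ 2 + k) * q ^ ((3 * k + 1) * (3 * k + 1 + 1) / 2) := by
    rw [← zpow_add₀ hq0, show (3 * k + 1) * (3 * k + 1 + 1) =
        15 * k ^ 2 + 11 * k + (1 - (3 * k ^ 2 + k)) * 2 by ring,
      Int.add_mul_ediv_right _ _ two_ne_zero]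
    congr 1
    ring
  rw [show 2 / phiNeg q * lambertTerm₁ q k = _ * _ from ?_]
  · exact h.congr_fun fun n => by ring
  · rw [lambertTerm₁, he]
    ring

/-- Uses $(-1;q)_n=2(-q;q)_{n-1}$ and $(1-q^n)/(1-q^{2n})=1/(1+q^n)$. -/
theorem baileyWeight_mul_eq_mod15Term {q : ℂ} (hq : ‖q‖ < 1) (n : ℕ+) :
    baileyWeight q n * ((1 - q ^ (n : ℕ)) * q ^ ((n : ℕ) ^ 2 - n) / qPoch q q (2 * n)) =
      2 * mod15Term q n := by
  obtain ⟨m, hm⟩ : ∃ m, (n : ℕ) = m + 1 := ⟨n - 1, (Nat.sub_add_cancel n.pos).symm⟩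
  rw [mod15Term, baileyWeight, hm]
  have e1 : (3 * (m + 1) ^ 2 - (m + 1)) / 2 =
      (m + 1) * (m + 1 + 1) / 2 + ((m + 1) ^ 2 - (m + 1)) := by
    have h1 : (m + 1) ^ 2 - (m + 1) = m * (m + 1) := by
      rw [sq, ← Nat.sub_one_mul, Nat.add_sub_cancel]
    have h2 : 3 * (m + 1) ^ 2 - (m + 1) = (m + 1) * (m + 1 + 1) + m * (m + 1) * 2 := by
      rw [Nat.sub_eq_iff_eq_add (by nlinarith)]
      ring
    rw [h1, h2, Nat.add_mul_div_right _ _ two_pos]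
  rw [e1, pow_add q (_ / 2), add_tsub_cancel_right, show 2 * (m + 1) - 1 = 2 * m + 1 by omega,
    show 2 * (m + 1) = 2 * m + 1 + 1 by ring, qPoch_succ q q (2 * m + 1), ← pow_succ',
    qPoch_neg_one_succ]
  have h1 := one_sub_pow_ne_zero hq (n := 2 * m + 1 + 1) (by omega)
  have h2 := qPoch_self_ne_zero hq (2 * m + 1)
  have h3 := one_add_pow_ne_zero hq (m + 1)
  have h4 : (1 - q ^ (m + 1)) / (1 - q ^ (2 * m + 1 + 1)) = 1 / (1 + q ^ (m + 1)) := by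
    rw [div_eq_div_iff h1 h3]
    ring
  rw [mul_comm (qPoch q q (2 * m + 1)), mul_div_mul_comm, h4]
  ring

end QSeries

theorem mainTheorem5 (q : ℂ) (hq0 : 0 < ‖q‖) (hq1 : ‖q‖ < 1) :
    QSeries.phiNeg q ≠ 0 ∧
    Summable (QSeries.mod15Term q) ∧
    Summable (QSeries.lambertTerm₀ q) ∧
    Summable (QSeries.lambertTerm₁ q) ∧
    ∑' n : ℕ+, QSeries.mod15Term q n =
      -(1 / QSeries.phiNeg q) * ∑' n : ℤ, QSeries.lambertTerm₀ q n +
        1 / QSeries.phiNeg q * ∑' n : ℤ, QSeries.lambertTerm₁ q n := by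
  have hq : q ≠ 0 := norm_pos_iff.mp hq0
  have hφ := QSeries.phiNeg_ne_zero hq1
  have hD₀ := QSeries.summable_prod_baileyWeight hq1 (QSeries.norm_coeff₀_le hq hq1)
    (e := fun k => 3 * k) (mul_right_injective₀ three_ne_zero)
  have hD₁ := QSeries.summable_prod_baileyWeight hq1 (QSeries.norm_coeff₁_le hq hq1)
    (e := fun k => 3 * k + 1) fun a b h => by
      simp only at h
      omega
  -- Summing the double series over `n` first gives the Lambert terms; `hD` sums over `k` first.
  have hL₀ := ((Equiv.prodComm ℤ ℕ).hasSum_iff.mpr hD₀.hasSum).prod_fiberwise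
    fun k => QSeries.hasSum_lambertTerm₀ hq hq1 k
  have hL₁ := ((Equiv.prodComm ℤ ℕ).hasSum_iff.mpr hD₁.hasSum).prod_fiberwise
    fun k => QSeries.hasSum_lambertTerm₁ hq hq1 k
  have hD := (hD₀.add hD₁).hasSum.prod_fiberwise fun n => ((hD₀.add hD₁).prod_factor n).hasSum
  have hβ (n : ℕ) := QSeries.tsum_baileyPair_sub hq hq1 n
  simp only [← mul_add, tsum_mul_left, hβ] at hD
  have hpos : HasSum (fun n : ℕ+ => 2 * QSeries.mod15Term q n) _ :=
    HasSum.congr_fun ((PNat.coe_injective.hasSum_iff fun n hn => ?_).mpr hD)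
      fun n => (QSeries.baileyWeight_mul_eq_mod15Term hq1 n).symm
  · have h2 : (2 : ℂ) ≠ 0 := two_ne_zero
    refine ⟨hφ, (summable_mul_left_iff h2).mp hpos.summable,
      (summable_mul_left_iff (by simp [hφ])).mp hL₀.summable,
      (summable_mul_left_iff (by simp [hφ])).mp hL₁.summable, ?_⟩
    have h3 := hpos.tsum_eq
    have h4 := hL₀.tsum_eq
    have h5 := hL₁.tsum_eq
    rw [tsum_mul_left] at h3 h4 h5
    simp only [mul_add, hD₀.tsum_add hD₁] at h3
    refine mul_left_cancel₀ h2 ?_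
    rw [h3, ← h4, ← h5]
    ring
  -- Only `n = 0` lies outside `ℕ+`, and there the factor `1 - q ^ n` vanishes.
  · have hn0 : n = 0 := by
      by_contra h
      exact hn ⟨⟨n, Nat.pos_of_ne_zero h⟩, rfl⟩
    simp [hn0]
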